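/- Let $G$ be a simple planar graph on $11$ vertices that contains no cycle of length $4$ as a (not necessarily induced) subgraph. Then the complement $G^c$ of $G$ contains a (not necessarily induced) subgraph isomorphic to the wheel $W_7$, where $W_n$ denotes the graph on $n+1$ vertices that consists of a cycle $C_n$ of length $n$ together with one further vertex (the hub) adjacent to every vertex of $C_n$. -/

import Mathlib

namespace SimpleGraph

/-- The wheel `W_n` (for `n ≥ 3`): a cycle `C_n` on the vertices `some i`, together with a hub
`none` adjacent to every vertex of that cycle. It has `n + 1` vertices. -/
def wheelGraph (n : ℕ) : SimpleGraph (Option (Fin n)) where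
  Adj
    | none, none => False
    | none, some _ => True
    | some _, none => True
    | some i, some j => (cycleGraph n).Adj i j
  symm := ⟨by
    rintro (_ | i) (_ | j) h
    · exact h
    · trivial
    · trivial
    · exact SimpleGraph.Adj.symm h⟩
  loopless := ⟨by
    rintro (_ | i) h
    · exact h
    · exact (cycleGraph n).loopless.irrefl i h⟩

/-- A drawing without crossings of a graph in the Euclidean plane: the vertices are distinct points,
every edge is a simple (injective, continuous) arc joining its two ends, no vertex lies in
the interior of an edge, and the interiors of distinct edges are disjoint. -/
structure PlaneEmbedding {V : Type*} (G : SimpleGraph V) where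
  /-- The points that represent the vertices. -/
  point : V → EuclideanSpace ℝ (Fin 2)
  /-- The arcs that represent the edges, parametrized by `[0, 1]`. -/
  arc : G.edgeSet → unitInterval → EuclideanSpace ℝ (Fin 2)
  point_injective : Function.Injective point
  arc_continuous : ∀ e, Continuous (arc e)
  arc_injective : ∀ e, Function.Injective (arc e)
  arc_ends : ∀ e : G.edgeSet, s(arc e 0, arc e 1) = Sym2.map point (e : Sym2 V)
  arc_avoids_points : ∀ e, ∀ t ∈ Set.Ioo (0 : unitInterval) 1, ∀ v, arc e t ≠ point v
  arcs_disjoint : ∀ e f, e ≠ f →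
    Disjoint (arc e '' Set.Ioo (0 : unitInterval) 1) (arc f '' Set.Ioo (0 : unitInterval) 1)

/-- A graph is planar if it can be drawn in the plane without crossings. -/
def IsPlanar {V : Type*} (G : SimpleGraph V) : Prop :=
  Nonempty G.PlaneEmbedding

end SimpleGraph

/-! Only the absence of four-cycles matters: two vertices then share at most one neighbour. The hub
`v` is chosen so that the vertices far from it carry a 7-cycle of the complement. The core is a
finite fact (`exists_mem_masks`): a graph on seven vertices has a four-cycle, a vertex with five
neighbours, or a Hamiltonian complement. If all degrees are at least 3, counting around a vertex
gives some `v` of degree exactly 3, hence seven far vertices, and bounds all degrees by 4, so the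
fact applies. Otherwise some `v` has at least eight far vertices; among eight of them, deleting one
of largest induced degree leaves seven to which the fact applies. -/

namespace SimpleGraph

/-! ### Backtracking search on binary masks -/

/-- The number `c` without the binary digits of `b`. -/
def eraseBits (b c : ℕ) : ℕ := Nat.xor c (Nat.land c b)

theorem testBit_eraseBits (b c i : ℕ) :
    (eraseBits b c).testBit i = (c.testBit i && !b.testBit i) := by
  change (c ^^^ (c &&& b)).testBit i = _
  rw [Nat.testBit_xor, Nat.testBit_and]
  cases c.testBit i <;> cases b.testBit i <;> rfl

/-- Passes to `k` the masks in `l` without the digits of `b`, and succeeds at once if one of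
these is empty. The case distinction makes the kernel evaluate every mask once. -/
noncomputable def shrinkThen (b : ℕ) (l : List ℕ) : (List ℕ → Bool) → Bool :=
  l.rec (fun k => k []) fun c _ ih k =>
    (eraseBits b c).casesOn true fun n => ih fun l' => k (n.succ :: l')

/-- Passes to `k` the masks in `l` that are disjoint from `b`. -/
noncomputable def disjointThen (b : ℕ) (l : List ℕ) : (List ℕ → Bool) → Bool :=
  l.rec (fun k => k []) fun c _ ih k =>
    (Nat.beq (Nat.land c b) 0).casesOn (ih k) (ih fun l' => k (c :: l'))

theorem of_shrinkThen {b : ℕ} {l : List ℕ} {k : List ℕ → Bool} (h : shrinkThen b l k = true) :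
    (∃ c ∈ l, eraseBits b c = 0) ∨ k (l.map (eraseBits b)) = true := by
  induction l generalizing k with
  | nil => exact Or.inr h
  | cons c l ih =>
    by_cases hc : eraseBits b c = 0
    · exact Or.inl ⟨c, by simp, hc⟩
    obtain ⟨n, hn⟩ := Nat.exists_eq_succ_of_ne_zero hc
    have h' : (eraseBits b c).casesOn (motive := fun _ => Bool) true
      (fun n => shrinkThen b l fun l' => k (n.succ :: l')) = true := h
    rw [hn] at h'
    rcases ih h' with ⟨x, hx, hx0⟩ | h1
    · exact Or.inl ⟨x, by simp [hx], hx0⟩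
    · rw [← hn] at h1
      exact Or.inr h1

theorem of_disjointThen {b : ℕ} {l : List ℕ} {k : List ℕ → Bool}
    (h : disjointThen b l k = true) : ∃ l', l' ⊆ l ∧ k l' = true := by
  induction l generalizing k with
  | nil => exact ⟨[], by simp, h⟩
  | cons c l ih =>
    have h' : (Nat.beq (Nat.land c b) 0).casesOn (motive := fun _ => Bool) (disjointThen b l k)
      (disjointThen b l fun l' => k (c :: l')) = true := h
    cases hc : Nat.beq (Nat.land c b) 0 <;> rw [hc] at h'
    · obtain ⟨l', h1, h2⟩ := ih h'
      exact ⟨l', fun x hx => List.mem_cons_of_mem _ (h1 hx), h2⟩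
    · obtain ⟨l', h1, h2⟩ := ih h'
      exact ⟨c :: l', List.cons_subset_cons c h1, h2⟩

/-- Backtracking search on sets of positions, given by their binary masks. It succeeds if every
set of positions contains a member of `F` or misses a member of `C`. The first member of `C`
determines the position on which to branch. -/
noncomputable def maskSearch (n : ℕ) : List ℕ → List ℕ → Bool :=
  n.rec (fun _ _ => false) fun _ ih F C => C.casesOn false fun c _ =>
    -- The leading digit of `c`, as `b.succ`. Both branches must succeed: first the position is
    -- absent from the set, then present.
    (Nat.pow 2 (Nat.log2 c)).casesOn false fun b =>
      (disjointThen b.succ F fun F' => shrinkThen b.succ C fun C' => ih F' C').casesOn false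
        (shrinkThen b.succ F fun F' => disjointThen b.succ C fun C' => ih F' C')

theorem of_eraseBits {A : ℕ → Prop} {d c : ℕ} (hd : A d)
    (h : ∀ e, (eraseBits (2 ^ d) c).testBit e = true → A e) (e : ℕ) (he : c.testBit e = true) :
    A e := by
  by_cases hde : d = e
  · exact hde ▸ hd
  · exact h e (by simp [testBit_eraseBits, he, hde])

/-- One branch of the search, stated once for both values of the decided position: replacing `A` by
its negation exchanges the two lists. The disjunction in `h` covers the two nesting orders. -/
theorem of_disjointThen_shrinkThen {A : ℕ → Prop} {d : ℕ} {F C : List ℕ}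
    {k : List ℕ → List ℕ → Bool} (hd : A d)
    (h : (∃ F', F' ⊆ F ∧ shrinkThen (2 ^ d) C (k F') = true) ∨
      shrinkThen (2 ^ d) C (fun C' => disjointThen (2 ^ d) F fun F' => k F' C') = true) :
    (∃ c ∈ C, ∀ e, c.testBit e = true → A e) ∨
      ∃ F', F' ⊆ F ∧ k F' (C.map (eraseBits (2 ^ d))) = true := by
  have key : ∀ c, eraseBits (2 ^ d) c = 0 → ∀ e, c.testBit e = true → A e :=
    fun c hc => of_eraseBits hd (by simp [hc])
  rcases h with ⟨F', hF', h⟩ | h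
  · rcases of_shrinkThen h with ⟨c, hc, h0⟩ | h
    · exact Or.inl ⟨c, hc, key c h0⟩
    · exact Or.inr ⟨F', hF', h⟩
  · rcases of_shrinkThen h with ⟨c, hc, h0⟩ | h
    · exact Or.inl ⟨c, hc, key c h0⟩
    · exact Or.inr (of_disjointThen h)

theorem exists_of_maskSearch (A : ℕ → Prop) (n : ℕ) (F C : List ℕ) (h : maskSearch n F C = true) :
    (∃ c ∈ F, ∀ e, c.testBit e = true → A e) ∨ ∃ c ∈ C, ∀ e, c.testBit e = true → ¬ A e := by
  induction n generalizing F C with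
  | zero => exact absurd h Bool.false_ne_true
  | succ n ih =>
    cases C with
    | nil => exact absurd h Bool.false_ne_true
    | cons c C =>
      generalize hd : c.log2 = d
      obtain ⟨b, hb⟩ := Nat.exists_eq_succ_of_ne_zero (pow_ne_zero d two_ne_zero)
      have h' : (Nat.pow 2 (Nat.log2 c)).casesOn (motive := fun _ => Bool) false (fun b =>
        (disjointThen b.succ F fun F' => shrinkThen b.succ (c :: C) fun C' =>
          maskSearch n F' C').casesOn false
        (shrinkThen b.succ F fun F' => disjointThen b.succ (c :: C) fun C' =>
          maskSearch n F' C')) = true := h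
      have hp : Nat.pow 2 (Nat.log2 c) = b.succ := by rw [hd]; exact hb
      rw [hp] at h'
      dsimp only at h'
      rw [← hb] at h'
      cases h0 : disjointThen (2 ^ d) F fun F' => shrinkThen (2 ^ d) (c :: C) fun C' =>
          maskSearch n F' C' <;> rw [h0] at h'
      · exact absurd h' Bool.false_ne_true
      by_cases hA : A d
      · rcases of_disjointThen_shrinkThen (k := fun C' F' => maskSearch n F' C') hA
          (Or.inr h') with h1 | ⟨C', hC', h1⟩
        · exact Or.inl h1
        refine (ih _ _ h1).imp ?_ fun ⟨x, hx, h2⟩ => ⟨x, hC' hx, h2⟩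
        rintro ⟨x, hx, h2⟩
        obtain ⟨y, hy, rfl⟩ := List.mem_map.1 hx
        exact ⟨y, hy, of_eraseBits hA h2⟩
      · rcases of_disjointThen_shrinkThen (A := fun e => ¬ A e) (k := maskSearch n) hA
          (Or.inl (of_disjointThen h0)) with h1 | ⟨F', hF', h1⟩
        · exact Or.inr h1
        refine (ih _ _ h1).imp (fun ⟨x, hx, h2⟩ => ⟨x, hF' hx, h2⟩) ?_
        rintro ⟨x, hx, h2⟩
        obtain ⟨y, hy, rfl⟩ := List.mem_map.1 hx
        exact ⟨y, hy, of_eraseBits (A := fun e => ¬ A e) hA h2⟩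

/-! ### Graphs on seven vertices as masks -/

/-- The number whose binary digits are the indicator of a list of positions. -/
def listMask (l : List ℕ) : ℕ := l.foldr (fun e m => m ||| 2 ^ e) 0

theorem testBit_listMask (l : List ℕ) (e : ℕ) : (listMask l).testBit e = true ↔ e ∈ l := by
  induction l with
  | nil => simp [listMask]
  | cons a l ih =>
    have h : listMask (a :: l) = listMask l ||| 2 ^ a := rfl
    rw [h, Nat.testBit_or, Bool.or_eq_true, ih, Nat.testBit_two_pow]
    simp [eq_comm, or_comm]

/-- The position that encodes the pair `{i, j}` of vertices. -/
def pairCode (i j : Fin 7) : ℕ := 48 - (7 * min i.val j.val + max i.val j.val)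

/-- The relation on positions that encodes the graph induced on a sequence of seven vertices. -/
def codeAdj {V : Type*} (G : SimpleGraph V) (f : Fin 7 → V) (e : ℕ) : Prop :=
  G.Adj (f (Fin.ofNat 7 ((48 - e) / 7))) (f (Fin.ofNat 7 (48 - e)))

theorem codeAdj_pairCode {V : Type*} (G : SimpleGraph V) (f : Fin 7 → V) (i j : Fin 7) :
    codeAdj G f (pairCode i j) ↔ G.Adj (f i) (f j) := by
  have key : ∀ i j : Fin 7,
      (Fin.ofNat 7 ((48 - pairCode i j) / 7) = i ∧ Fin.ofNat 7 (48 - pairCode i j) = j) ∨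
      (Fin.ofNat 7 ((48 - pairCode i j) / 7) = j ∧ Fin.ofNat 7 (48 - pairCode i j) = i) := by
    decide
  rw [codeAdj]
  rcases key i j with h | h
  · rw [h.1, h.2]
  · rw [h.1, h.2, G.adj_comm]

/-- The codes of the edges of the closed walk that visits the vertices of `p` in order. -/
def cycleCodes (p : List (Fin 7)) : List ℕ :=
  (List.range p.length).map fun i => pairCode (p.getD i 0) (p.getD ((i + 1) % p.length) 0)

/-- The four-cycles on `Fin 7`, as lists of vertices. -/
def fourCycles : List (List (Fin 7)) :=
  (List.finRange 7).flatMap fun i => (List.finRange 7).flatMap fun j =>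
    (List.finRange 7).flatMap fun k => (List.finRange 7).filterMap fun l =>
      -- The least vertex comes first and `j < l` fixes the direction, so each cycle is listed once.
      if i < j ∧ j < l ∧ i < k ∧ k ≠ j ∧ k ≠ l then some [i, j, k, l] else none

/-- The spanning cycles on `Fin 7`, as lists of vertices. -/
def spanningCycles : List (List (Fin 7)) :=
  (([1, 2, 3, 4, 5, 6] : List (Fin 7)).permutations'.filter
    fun p => p.getD 0 0 < p.getD 5 0).map (0 :: ·)

/-- The centres and the sets of leaves of the five-leaf stars on `Fin 7`. -/
def fiveStars : List (Fin 7 × List (Fin 7)) :=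
  (List.finRange 7).flatMap fun i =>
    (((List.finRange 7).filter (· ≠ i)).sublistsLen 5).map fun t => (i, t)

/-- The masks of the four-cycles and of the five-leaf stars. -/
def obstructionMasks : List ℕ :=
  fourCycles.map (fun p => listMask (cycleCodes p)) ++
    fiveStars.map fun t => listMask (t.2.map (pairCode t.1))

/-- The masks of the spanning cycles. -/
def spanningMasks : List ℕ := spanningCycles.map fun p => listMask (cycleCodes p)

/-- Erasing `0` changes no mask; it only evaluates the lists before the search. Depth 22 suffices
for the 21 pairs. -/
theorem maskSearch_seven : (shrinkThen 0 obstructionMasks fun F => shrinkThen 0 spanningMasks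
    fun C => maskSearch 22 F C) = true := by
  decide +kernel

theorem exists_mem_masks (A : ℕ → Prop) :
    (∃ c ∈ obstructionMasks, ∀ e, c.testBit e = true → A e) ∨
      ∃ c ∈ spanningMasks, ∀ e, c.testBit e = true → ¬ A e := by
  have h0 : ∀ c, eraseBits 0 c = c := fun c => Nat.eq_of_testBit_eq fun i => by
    simp [testBit_eraseBits]
  have hmap : ∀ l : List ℕ, l.map (eraseBits 0) = l := fun l =>
    (List.map_congr_left fun c _ => h0 c).trans (List.map_id' l)
  rcases of_shrinkThen maskSearch_seven with ⟨c, hc, h⟩ | h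
  · rw [h0] at h
    exact Or.inl ⟨c, hc, by simp [h]⟩
  rcases of_shrinkThen h with ⟨c, hc, h⟩ | h
  · rw [h0] at h
    exact Or.inr ⟨c, hc, by simp [h]⟩
  rw [hmap, hmap] at h
  exact exists_of_maskSearch A _ _ _ h

theorem mem_spanningCycles {p : List (Fin 7)} (hp : p ∈ spanningCycles) :
    p.length = 7 ∧ p.Nodup := by
  obtain ⟨q, hq, rfl⟩ := List.mem_map.1 hp
  have h := List.mem_permutations'.1 (List.mem_of_mem_filter hq)
  have := (h.cons 0)
  exact ⟨by simpa using this.length_eq, this.nodup_iff.2 (by decide)⟩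

theorem mem_fourCycles {p : List (Fin 7)} (hp : p ∈ fourCycles) :
    ∃ i j k l, p = [i, j, k, l] ∧ i ≠ k ∧ j ≠ l := by
  simp only [fourCycles, List.mem_flatMap, List.mem_filterMap, Option.ite_none_right_eq_some,
    Option.some.injEq] at hp
  obtain ⟨i, -, j, -, k, -, l, -, h, rfl⟩ := hp
  exact ⟨i, j, k, l, rfl, h.2.2.1.ne, h.2.1.ne⟩

theorem mem_fiveStars {t : Fin 7 × List (Fin 7)} (ht : t ∈ fiveStars) :
    t.2.length = 5 ∧ t.2.Nodup := by
  simp only [fiveStars, List.mem_flatMap, List.mem_map] at ht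
  obtain ⟨i, -, s, hs, rfl⟩ := ht
  obtain ⟨h1, h2⟩ := List.mem_sublistsLen.1 hs
  exact ⟨h2, h1.nodup ((List.nodup_finRange 7).filter _)⟩

/-! ### Square-free graphs and 7-cycles of the complement -/

/-- A graph is square-free if it has no four-cycle `a b c d`. -/
def SquareFree {V : Type*} (G : SimpleGraph V) : Prop :=
  ∀ a b c d, a ≠ c → b ≠ d → G.Adj a b → G.Adj b c → G.Adj c d → ¬ G.Adj d a

theorem squareFree_of_free {V : Type*} {G : SimpleGraph V} (h : (cycleGraph 4).Free G) :
    G.SquareFree := by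
  intro a b c d hac hbd hab hbc hcd hda
  refine h ⟨⟨⟨![a, b, c, d], ?_⟩, ?_⟩⟩
  · intro i j hij
    rw [cycleGraph_adj] at hij
    fin_cases i <;> fin_cases j <;> first | exact absurd hij (by decide) | skip
    all_goals simp [hab, hbc, hcd, hda, hab.symm, hbc.symm, hcd.symm, hda.symm]
  · intro i j hij
    have := hab.ne; have := hbc.ne; have := hcd.ne; have := hda.ne
    fin_cases i <;> fin_cases j <;> simp_all

variable {V : Type*} {G : SimpleGraph V}

/-- Seven vertices of a square-free graph with at most four neighbours each among them
can be arranged in a cycle of the complement. -/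
theorem exists_spanning_cycle_compl (hG : G.SquareFree) (f : Fin 7 → V)
    (hf : Function.Injective f)
    (hdeg : ∀ i (t : Finset (Fin 7)), (∀ j ∈ t, G.Adj (f i) (f j)) → t.card ≤ 4) :
    ∃ σ : Fin 7 → Fin 7, Function.Injective σ ∧ ∀ i, ¬ G.Adj (f (σ i)) (f (σ (i + 1))) := by
  rcases exists_mem_masks (codeAdj G f) with ⟨c, hc, h⟩ | ⟨c, hc, h⟩
  · exfalso
    rcases List.mem_append.1 hc with hc | hc
    · obtain ⟨p, hp, rfl⟩ := List.mem_map.1 hc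
      obtain ⟨i, j, k, l, rfl, hik, hjl⟩ := mem_fourCycles hp
      simp only [testBit_listMask, cycleCodes, List.mem_map, List.mem_range] at h
      have key : ∀ m < 4,
          G.Adj (f ([i, j, k, l].getD m 0)) (f ([i, j, k, l].getD ((m + 1) % 4) 0)) :=
        fun m hm => (codeAdj_pairCode G f _ _).1 (h _ ⟨m, hm, rfl⟩)
      exact hG (f i) (f j) (f k) (f l) (hf.ne hik) (hf.ne hjl) (key 0 (by decide))
        (key 1 (by decide)) (key 2 (by decide)) (key 3 (by decide))
    · obtain ⟨t, ht, rfl⟩ := List.mem_map.1 hc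
      obtain ⟨h1, h2⟩ := mem_fiveStars ht
      have := hdeg t.1 t.2.toFinset fun j hj => (codeAdj_pairCode G f _ _).1
        (h _ ((testBit_listMask _ _).2 (List.mem_map_of_mem (List.mem_toFinset.1 hj))))
      rw [List.toFinset_card_of_nodup h2, h1] at this
      omega
  · obtain ⟨p, hp, rfl⟩ := List.mem_map.1 hc
    obtain ⟨h1, h2⟩ := mem_spanningCycles hp
    refine ⟨fun i => p.getD i 0, fun i j hij => ?_, fun i hi => ?_⟩
    · have hi : i.val < p.length := by omega
      have hj : j.val < p.length := by omega
      simp only [List.getD_eq_getElem _ _ hi, List.getD_eq_getElem _ _ hj] at hij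
      exact Fin.ext ((h2.getElem_inj_iff).1 hij)
    · refine h _ ((testBit_listMask _ _).2 (List.mem_map.2 ⟨i.val, by simp [h1], rfl⟩))
        ((codeAdj_pairCode G f _ _).2 ?_)
      have : ((i + 1 : Fin 7) : ℕ) = (i.val + 1) % p.length := by rw [h1, Fin.val_add]; rfl
      rwa [← this]

section Finite

open Classical Finset

theorem SquareFree.card_inter_le_one [Fintype V] (hG : G.SquareFree) {u v : V} (huv : u ≠ v) :
    #(G.neighborFinset u ∩ G.neighborFinset v) ≤ 1 := by
  refine card_le_one.2 fun a ha b hb => ?_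
  simp only [mem_inter, mem_neighborFinset] at ha hb
  by_contra hab
  exact hG u a v b huv hab ha.1 ha.2.symm hb.2 hb.1.symm

/-- The neighbours of `v` in `S`. -/
noncomputable def neighborsIn (G : SimpleGraph V) (S : Finset V) (v : V) : Finset V :=
  S.filter fun w => G.Adj v w

theorem SquareFree.card_neighborsIn_add [Fintype V] (hG : G.SquareFree) {u v : V} (huv : u ≠ v)
    (S : Finset V) : #(G.neighborsIn S u) + #(G.neighborsIn S v) ≤ #S + 1 := by
  rw [← card_union_add_card_inter]
  refine add_le_add (card_le_card (union_subset (filter_subset _ _) (filter_subset _ _)))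
    ((card_le_card fun w hw => ?_).trans (hG.card_inter_le_one huv))
  simp only [neighborsIn, mem_inter, mem_filter, mem_neighborFinset] at hw ⊢
  exact ⟨hw.1.2, hw.2.2⟩

/-- A cycle of length seven of the complement on the vertices in `S`. -/
def HasComplCycle (G : SimpleGraph V) (S : Finset V) : Prop :=
  ∃ g : Fin 7 → V, Function.Injective g ∧ (∀ i, g i ∈ S) ∧ ∀ i, ¬ G.Adj (g i) (g (i + 1))

theorem SquareFree.hasComplCycle_of_card_eq_seven (hG : G.SquareFree) {S : Finset V}
    (hS : #S = 7) (hdeg : ∀ v ∈ S, #(G.neighborsIn S v) ≤ 4) : G.HasComplCycle S := by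
  let e := (S.equivFinOfCardEq hS).symm
  have he : Function.Injective fun i => (e i : V) := Subtype.val_injective.comp e.injective
  obtain ⟨σ, h1, h2⟩ := exists_spanning_cycle_compl hG (fun i => (e i : V)) he fun i t ht => by
    refine le_trans ?_ (hdeg _ (e i).2)
    rw [← card_image_of_injective t he]
    refine card_le_card fun w hw => ?_
    obtain ⟨j, hj, rfl⟩ := mem_image.1 hw
    exact mem_filter.2 ⟨(e j).2, ht j hj⟩
  exact ⟨fun i => e (σ i), he.comp h1, fun i => (e (σ i)).2, h2⟩

theorem SquareFree.hasComplCycle_of_card_eq_eight [Fintype V] (hG : G.SquareFree) {S : Finset V}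
    (hS : #S = 8) : G.HasComplCycle S := by
  obtain ⟨v, hv, hmax⟩ := S.exists_max_image (fun v => #(G.neighborsIn S v))
    (card_pos.1 (by omega))
  obtain ⟨g, h1, h2, h3⟩ := hG.hasComplCycle_of_card_eq_seven (S := S.erase v)
    (by rw [card_erase_of_mem hv, hS]) fun w hw => by
      have hle : #(G.neighborsIn (S.erase v) w) ≤ #(G.neighborsIn S w) :=
        card_le_card (filter_subset_filter _ (erase_subset _ _))
      -- The two degrees in `S` sum to at most 9, so the smaller one, that of `w`, is at most 4.
      have := hmax w (mem_of_mem_erase hw)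
      have := hG.card_neighborsIn_add (ne_of_mem_erase hw) S
      omega
  exact ⟨g, h1, fun i => mem_of_mem_erase (h2 i), h3⟩

/-! ### Degree counts on eleven vertices and the hub -/

variable [Fintype V]

/-- The vertices at distance at least two from `w`. -/
noncomputable def farVertices (G : SimpleGraph V) (w : V) : Finset V :=
  (insert w (G.neighborFinset w))ᶜ

theorem mem_farVertices {v w : V} : v ∈ G.farVertices w ↔ v ≠ w ∧ ¬ G.Adj w v := by
  simp [farVertices]

theorem card_farVertices_add (w : V) :
    #(G.farVertices w) + G.degree w + 1 = Fintype.card V := by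
  have := card_compl_add_card (insert w (G.neighborFinset w))
  rwa [card_insert_of_notMem (by simp), card_neighborFinset_eq_degree, ← add_assoc] at this

theorem Adj.degree_eq_add {w x : V} (h : G.Adj w x) : G.degree x =
    1 + #(G.neighborFinset x ∩ G.neighborFinset w) + #(G.neighborFinset x ∩ G.farVertices w) := by
  have hxw : w ∈ G.neighborFinset x := (G.mem_neighborFinset x w).2 h.symm
  have h1 := card_inter_add_card_sdiff (G.neighborFinset x) (insert w (G.neighborFinset w))
  rw [inter_insert_of_mem hxw, card_insert_of_notMem (by simp), sdiff_eq_inter_compl] at h1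
  rw [← card_neighborFinset_eq_degree, farVertices]
  omega

/-- The neighbours of `w` have disjoint sets of neighbours far from `w`. -/
theorem SquareFree.sum_card_inter_farVertices_le (hG : G.SquareFree) (w : V) :
    ∑ x ∈ G.neighborFinset w, #(G.neighborFinset x ∩ G.farVertices w) ≤ #(G.farVertices w) := by
  rw [← card_biUnion]
  · exact card_le_card (biUnion_subset.2 fun x _ => inter_subset_right)
  · intro x hx y hy hxy
    rw [Function.onFun, Finset.disjoint_left]
    intro z hzx hzy
    simp only [mem_inter, mem_neighborFinset, mem_farVertices] at hzx hzy
    exact hG w x z y (Ne.symm hzx.2.1) hxy ((G.mem_neighborFinset w x).1 hx) hzx.1 hzy.1.symm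
      ((G.mem_neighborFinset w y).1 hy).symm

/-- If all degrees were at least 4, each neighbour of `w` would have two far neighbours, so 2d ≤ 10
- d for d the degree of `w`, forcing d ≤ 3. -/
theorem SquareFree.exists_degree_le_three (hG : G.SquareFree) (hV : Fintype.card V = 11) :
    ∃ v, G.degree v ≤ 3 := by
  by_contra! hmin
  obtain ⟨w⟩ : Nonempty V := Fintype.card_pos_iff.1 (by omega)
  have hout : ∀ x ∈ G.neighborFinset w, 2 ≤ #(G.neighborFinset x ∩ G.farVertices w) := by
    intro x hx
    have hwx := (G.mem_neighborFinset w x).1 hx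
    have := hmin x
    have := hwx.degree_eq_add
    have := hG.card_inter_le_one hwx.ne'
    omega
  have hge := (sum_le_sum hout).trans (hG.sum_card_inter_farVertices_le w)
  rw [sum_const, card_neighborFinset_eq_degree, smul_eq_mul] at hge
  have := G.card_farVertices_add w
  have := hmin w
  omega

/-- In a square-free graph on eleven vertices of minimum degree at least three,
all degrees are at most four. -/
theorem SquareFree.degree_le_four (hG : G.SquareFree) (hV : Fintype.card V = 11)
    (hmin : ∀ v, 3 ≤ G.degree v) (w : V) : G.degree w ≤ 4 := by
  by_contra! hw
  set N := G.neighborFinset w with hN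
  have hcardN : #N = G.degree w := G.card_neighborFinset_eq_degree w
  have hadj : ∀ x ∈ N, G.Adj w x := fun x hx => (G.mem_neighborFinset w x).1 hx
  have hdeg : ∀ x ∈ N, G.degree x =
      1 + #(G.neighborFinset x ∩ N) + #(G.neighborFinset x ∩ G.farVertices w) :=
    fun x hx => (hadj x hx).degree_eq_add
  have hin : ∀ x ∈ N, #(G.neighborFinset x ∩ N) ≤ 1 := fun x hx =>
    hG.card_inter_le_one (hadj x hx).ne'
  have hout : ∀ x ∈ N, 1 ≤ #(G.neighborFinset x ∩ G.farVertices w) := fun x hx => by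
    have := hmin x; have := hdeg x hx; have := hin x hx
    omega
  have hle : ∑ x ∈ N, #(G.neighborFinset x ∩ G.farVertices w) ≤ #(G.farVertices w) :=
    hG.sum_card_inter_farVertices_le w
  have hge : #N ≤ ∑ x ∈ N, #(G.neighborFinset x ∩ G.farVertices w) := by
    simpa using sum_le_sum hout
  have hfar := G.card_farVertices_add w
  -- From d ≤ 10 - d. Equality then makes every neighbour of `w` have exactly one far neighbour and
  -- exactly one neighbour in `N`.
  have hdw : G.degree w = 5 := by omega
  have hout' : ∀ x ∈ N, #(G.neighborFinset x ∩ G.farVertices w) = 1 := fun x hx =>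
    ((sum_eq_sum_iff_of_le hout).1
      (by simp only [sum_const, smul_eq_mul, mul_one]; omega) x hx).symm
  have hin' : ∀ x ∈ N, #(G.neighborFinset x ∩ N) = 1 := fun x hx => by
    have := hmin x; have := hdeg x hx; have := hin x hx; have := hout' x hx
    omega
  have hsum : ∑ x : N, (G.induce (N : Set V)).degree x = 5 := by
    rw [← hdw, ← hcardN]
    trans ∑ x : N, 1
    · refine sum_congr rfl fun x _ => ?_
      rw [← hin' x x.2, ← card_neighborFinset_eq_degree]
      refine card_bij (fun y _ => y.1) (fun y hy => ?_) (fun y _ z _ h => Subtype.ext h) ?_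
      · simp only [mem_neighborFinset, comap_adj, mem_inter] at hy ⊢
        exact ⟨hy, y.2⟩
      · intro z hz
        rw [mem_inter, mem_neighborFinset] at hz
        exact ⟨⟨z, hz.2⟩, by simpa using hz.1, rfl⟩
    · simp
  -- A 1-regular graph on five vertices contradicts the handshake lemma.
  have h2 := (G.induce (N : Set V)).sum_degrees_eq_twice_card_edges
  have h5 : ∑ x, (G.induce (N : Set V)).degree x = 5 := by convert hsum
  omega

theorem SquareFree.exists_hub (hG : G.SquareFree) (hV : Fintype.card V = 11) :
    ∃ v, G.HasComplCycle (G.farVertices v) := by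
  have hcard : ∀ v, #(G.farVertices v) + G.degree v + 1 = 11 := fun v => by
    rw [G.card_farVertices_add, hV]
  by_cases hmin : ∀ v, 3 ≤ G.degree v
  · obtain ⟨v, hv⟩ := hG.exists_degree_le_three hV
    refine ⟨v, hG.hasComplCycle_of_card_eq_seven (by have := hcard v; have := hmin v; omega)
      fun w _ => le_trans (card_le_card fun x hx => ?_) (hG.degree_le_four hV hmin w)⟩
    exact (mem_neighborFinset _ _ _).2 (mem_filter.1 hx).2
  · push Not at hmin
    obtain ⟨v, hv⟩ := hmin
    obtain ⟨S, hS, hS8⟩ := exists_subset_card_eq (s := G.farVertices v) (n := 8)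
      (by have := hcard v; omega)
    obtain ⟨g, h1, h2, h3⟩ := hG.hasComplCycle_of_card_eq_eight hS8
    exact ⟨v, g, h1, fun i => hS (h2 i), h3⟩

/-- The complement of a square-free graph on eleven vertices contains the wheel `W_7`,
whether or not the graph is planar. -/
theorem SquareFree.wheelGraph_isContained_compl (hG : G.SquareFree) (hV : Fintype.card V = 11) :
    (wheelGraph 7).IsContained Gᶜ := by
  obtain ⟨v, g, hg, hmem, hadj⟩ := hG.exists_hub hV
  have hv : ∀ i, Gᶜ.Adj v (g i) := fun i =>
    have h := mem_farVertices.1 (hmem i)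
    (G.compl_adj _ _).2 ⟨Ne.symm h.1, h.2⟩
  have hc : ∀ i, Gᶜ.Adj (g i) (g (i + 1)) := fun i =>
    (G.compl_adj _ _).2 ⟨hg.ne (by revert i; decide), hadj i⟩
  refine ⟨⟨⟨fun o => o.elim v g, ?_⟩, ?_⟩⟩
  · rintro (_ | i) (_ | j) h
    · exact h.elim
    · exact hv j
    · exact (hv i).symm
    · rcases (cycleGraph_adj.1 h : i - j = 1 ∨ j - i = 1) with h | h
      · rw [sub_eq_iff_eq_add'.1 h]; exact (hc j).symm
      · rw [sub_eq_iff_eq_add'.1 h]; exact hc i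
  · rintro (_ | i) (_ | j) h
    · rfl
    · exact absurd h (hv j).ne
    · exact absurd h (hv i).ne'
    · exact congrArg some (hg h)

end Finite

end SimpleGraph

theorem mainTheorem6 {V : Type*} [Fintype V] (hV : Fintype.card V = 11)
    (G : SimpleGraph V) (hplanar : G.IsPlanar) (hC4 : (SimpleGraph.cycleGraph 4).Free G) :
    (SimpleGraph.wheelGraph 7).IsContained Gᶜ :=
  (SimpleGraph.squareFree_of_free hC4).wheelGraph_isContained_compl hV
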